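/- Let $\mathbb{D}=\{z\in\mathbb{C}:|z|<1\}$. For $\lambda>0$ let $\mathcal{B}_H(\lambda)$ be the class of harmonic mappings $f=h+\overline{g}$ in $\mathbb{D}$, with $h$ and $g$ analytic in $\mathbb{D}$ and $h(0)=g(0)=h'(0)-1=0$, such that $$\|T_f\|:=\sup_{z\in\mathbb{D},\ \theta\in[0,2\pi]}(1-|z|^2)\left|\frac{h''(z)+e^{i\theta}g''(z)}{h'(z)+e^{i\theta}g'(z)}\right|\le 2\lambda,$$ where the quotient is regarded as infinite at any point where its denominator vanishes (so $|h'|\neq|g'|$ everywhere in $\mathbb{D}$ for $f\in\mathcal{B}_H(\lambda)$). For $0<p<\infty$ let $h^p$ be the space of all complex-valued harmonic functions $f$ in $\mathbb{D}$ for which $$M_p(r,f)=\left\{\frac{1}{2\pi}\int_0^{2\pi}|f(re^{i\theta})|^p\,d\theta\right\}^{1/p}$$ is bounded on $0<r<1$. Theorem. Let $\lambda\ge 1$. Then $\mathcal{B}_H(\lambda)\subset h^p$ for every $p$ with $0<p<\dfrac{1}{\lambda^2-1}$, where $\dfrac{1}{\lambda^2-1}$ is interpreted as $\infty$ when $\lambda=1$.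 -/

import Mathlib

open Set Metric ComplexConjugate
open scoped ENNReal

noncomputable section

/-- The pre-Schwarzian norm `‖T_f‖` of `f = h + conj g` on the unit disk, the supremum over
`|z| < 1` and `θ ∈ [0, 2π]` of `(1 - |z|²) |(h'' + e^{iθ} g'') / (h' + e^{iθ} g')|`.
It takes values in `[0, ∞]`; the quotient counts as infinite where its denominator vanishes,
so a finite norm forces `|h'| ≠ |g'|` throughout the disk (local univalence). -/
def preSchwarzianNorm (h g : ℂ → ℂ) : ℝ≥0∞ :=
  ⨆ z ∈ ball (0 : ℂ) 1, ⨆ θ ∈ Icc (0 : ℝ) (2 * Real.pi),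
    if deriv h z + Complex.exp (θ * Complex.I) * deriv g z = 0 then ⊤
    else ENNReal.ofReal ((1 - ‖z‖ ^ 2) *
      ‖(deriv (deriv h) z + Complex.exp (θ * Complex.I) * deriv (deriv g) z) /
        (deriv h z + Complex.exp (θ * Complex.I) * deriv g z)‖)

/-- `f = h + conj g` on the unit disk, with `h`, `g` analytic there and
`h(0) = g(0) = h'(0) - 1 = 0`. -/
structure IsNormalizedDecomposition (f h g : ℂ → ℂ) : Prop where
  analytic_h : DifferentiableOn ℂ h (ball 0 1)
  analytic_g : DifferentiableOn ℂ g (ball 0 1)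
  eq_add_conj : ∀ z ∈ ball (0 : ℂ) 1, f z = h z + conj (g z)
  h_zero : h 0 = 0
  g_zero : g 0 = 0
  deriv_h_zero : deriv h 0 = 1

/-- The class `B_H(lam)` of normalized harmonic mappings `f = h + conj g` of the unit disk with
`‖T_f‖ ≤ 2 lam`. Functions are total on `ℂ`, but only their values on the disk matter. -/
def harmonicB (lam : ℝ) : Set (ℂ → ℂ) :=
  {f | ∃ h g : ℂ → ℂ, IsNormalizedDecomposition f h g ∧
    preSchwarzianNorm h g ≤ ENNReal.ofReal (2 * lam)}

/-- The integral mean `M_p(r, f)`. -/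
def integralMean (p r : ℝ) (f : ℂ → ℂ) : ℝ :=
  (1 / (2 * Real.pi) *
    ∫ θ in (0 : ℝ)..(2 * Real.pi), ‖f (r * Complex.exp (θ * Complex.I))‖ ^ p) ^ (1 / p)

/-- The harmonic Hardy space `h^p`: complex-valued harmonic functions on the unit disk whose
integral means `M_p(r, f)`, `0 < r < 1`, are bounded. -/
def harmonicHardy (p : ℝ) : Set (ℂ → ℂ) :=
  {f | InnerProductSpace.HarmonicOnNhd f (ball 0 1) ∧
    BddAbove ((fun r : ℝ => integralMean p r f) '' Ioo 0 1)}

end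

/-!
For `f = h + conj g`, only the two values `ε = ±1` of `e^{iθ}` are needed: since
`2h = (h + g) + (h - g)` and `2g = (h + g) - (h - g)`, one has `|f| ≤ |h + g| + |h - g|`
(`norm_add_conj_rpow_le`), so it suffices to bound the `p`-means of each analytic function
`F = h ± g`. Such an `F` satisfies `F(0) = 0`, `F' ≠ 0` and `(1 - |z|²) |F''/F'| ≤ 2 lam`; hence
`F' = exp G` with `G` analytic and `|G'| ≤ 2 lam / (1 - |z|²)`.

*Means of `F'`.* Put `φ = exp (pG/2)`, so that `|φ|² = |F'|^p` and `|φ'| ≤ p lam |φ| / (1 - |z|²)`.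
If `c n` are the squared moduli of the Taylor coefficients of `φ` and `J(x) = ∑ c n x^n`, Parseval's
identity on `|z|² = x` turns this into the differential inequality
`(x J')' ≤ (p lam)² J / (1 - x)²`. Near `x = 1` the function `(1 - x)^(-a)` satisfies the reverse
inequality as soon as `a + a² > (p lam)²`, and comparison gives `J(x) = O((1 - x)^(-a))`
(`exists_tsum_le_one_sub_rpow`). The hypothesis `p (lam² - 1) < 1` says precisely that
`p + p² > (p lam)²`, so an exponent `a < p` is available (`exists_lt_sq_lt_add_sq`).

*Means of `F`.* The bound on `G'` is a Harnack inequality: `|F'|` varies by at most the factor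
`exp (2 lam)` on the radial segment between the circles of radii `1 - 2^(-k)` and `1 - 2^(-k-1)`.
So `|F|` is at most a constant times `∑ 2^(-k) |F'|`, with `F'` taken at the dyadic radii
(`norm_radial_le_sum_dyadic`). Giving up a small geometric factor moves the power `p` inside the sum
for every `p > 0`, both below and above `1` (`sum_geometric_mul_rpow_le`), and integration leaves a
geometric series of ratio `2^((a - p)/2) < 1`.
-/

/-! ### Power series with nonnegative coefficients and a comparison principle -/

/-- The tangent line bound for `t ↦ t ^ n` at `ρ`, without the constant term. -/
theorem natCast_mul_pow_mul_le {ρ d : ℝ} (hρ : 0 ≤ ρ) (hd : 0 ≤ d) (n : ℕ) :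
    (n : ℝ) * ρ ^ (n - 1) * d ≤ (ρ + d) ^ n := by
  induction n with
  | zero => simp
  | succ n ih =>
    have h1 : ρ ^ n ≤ (ρ + d) ^ n := pow_le_pow_left₀ hρ (by linarith) n
    rcases n with _ | n
    · simpa using hρ
    · simp only [Nat.add_sub_cancel] at ih ⊢
      have h2 := mul_le_mul_of_nonneg_left ih hρ
      have h3 := mul_le_mul_of_nonneg_right h1 hd
      calc ((n + 1 + 1 : ℕ) : ℝ) * ρ ^ (n + 1) * d
          = ρ * (((n + 1 : ℕ) : ℝ) * ρ ^ n * d) + ρ ^ (n + 1) * d := by push_cast; ring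
        _ ≤ ρ * (ρ + d) ^ (n + 1) + (ρ + d) ^ (n + 1) * d := by linarith
        _ = (ρ + d) ^ (n + 1 + 1) := by ring

theorem summable_natCast_mul_pow_pred {c : ℕ → ℝ} (hc : ∀ n, 0 ≤ c n)
    (hs : ∀ x ∈ Ico (0 : ℝ) 1, Summable fun n => c n * x ^ n) {ρ : ℝ} (hρ : ρ ∈ Ico (0 : ℝ) 1) :
    Summable fun n => c n * (n * ρ ^ (n - 1)) := by
  have hd : 0 < (1 - ρ) / 2 := by linarith [hρ.2]
  have hx : ρ + (1 - ρ) / 2 ∈ Ico (0 : ℝ) 1 := ⟨by linarith [hρ.1], by linarith [hρ.2]⟩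
  refine Summable.of_nonneg_of_le (fun n => ?_) (fun n => ?_)
    ((hs _ hx).mul_right ((1 - ρ) / 2)⁻¹)
  · have := hρ.1
    have := hc n
    positivity
  · rw [← div_eq_mul_inv, le_div_iff₀ hd, mul_assoc]
    exact mul_le_mul_of_nonneg_left (natCast_mul_pow_mul_le hρ.1 hd.le n) (hc n)

theorem hasDerivAt_tsum_mul_pow {c : ℕ → ℝ} (hc : ∀ n, 0 ≤ c n)
    (hs : ∀ x ∈ Ico (0 : ℝ) 1, Summable fun n => c n * x ^ n) {x : ℝ} (hx : x ∈ Ico (0 : ℝ) 1) :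
    HasDerivAt (fun y => ∑' n, c n * y ^ n) (∑' n, c n * (n * x ^ (n - 1))) x := by
  obtain ⟨ρ, h1, h2⟩ := exists_between hx.2
  have hρ : ρ ∈ Ico (0 : ℝ) 1 := ⟨hx.1.trans h1.le, h2⟩
  refine hasDerivAt_tsum_of_isPreconnected (t := Ioo (-ρ) ρ) (y₀ := x)
    (summable_natCast_mul_pow_pred hc hs hρ) isOpen_Ioo isPreconnected_Ioo
    (g' := fun n y => c n * (n * y ^ (n - 1)))
    (fun n y _ => (hasDerivAt_pow n y).const_mul (c n)) (fun n y hy => ?_)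
    ⟨by linarith [hx.1], h1⟩ (hs x hx) ⟨by linarith [hx.1], h1⟩
  rw [norm_mul, norm_mul, norm_pow, Real.norm_of_nonneg (hc n), Real.norm_natCast]
  have : ‖y‖ ≤ ρ := by rw [Real.norm_eq_abs, abs_le]; exact ⟨hy.1.le, hy.2.le⟩
  have := hc n
  gcongr

/-- Comparison principle for the system `D' = E / x`: if `E' ≥ 0` wherever `D ≥ 0`, then `D` stays
positive once both `D` and `E` are positive. -/
theorem pos_of_hasDerivAt_div {x₀ : ℝ} (hx₀ : 0 < x₀) {D E E' : ℝ → ℝ}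
    (hD : ∀ x ∈ Ico x₀ 1, HasDerivAt D (E x / x) x) (hE : ∀ x ∈ Ico x₀ 1, HasDerivAt E (E' x) x)
    (hE' : ∀ x ∈ Ico x₀ 1, 0 ≤ D x → 0 ≤ E' x) (hD₀ : 0 < D x₀) (hE₀ : 0 < E x₀) :
    ∀ x ∈ Ico x₀ 1, 0 < D x := by
  intro x₁ hx₁
  by_contra! hneg
  have hsub : Icc x₀ x₁ ⊆ Ico x₀ 1 := fun x hx => ⟨hx.1, hx.2.trans_lt hx₁.2⟩
  have hcD : ContinuousOn D (Icc x₀ x₁) :=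
    fun x hx => (hD x (hsub hx)).continuousAt.continuousWithinAt
  -- the first point `y` at which `D ≤ 0`; on `[x₀, y]` both `E` and `D` increase
  have hcomp : IsCompact (Icc x₀ x₁ ∩ D ⁻¹' Iic 0) :=
    isCompact_Icc.of_isClosed_subset (hcD.preimage_isClosed_of_isClosed isClosed_Icc isClosed_Iic)
      inter_subset_left
  obtain ⟨y, ⟨hy, hDy⟩, hmin⟩ := hcomp.exists_isLeast ⟨x₁, ⟨hx₁.1, le_rfl⟩, hneg⟩
  have hpos : ∀ x ∈ Ico x₀ y, 0 < D x := fun x hx => by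
    by_contra! h
    exact absurd (hmin ⟨⟨hx.1, hx.2.le.trans hy.2⟩, h⟩) (not_le.2 hx.2)
  have hsub' : Icc x₀ y ⊆ Ico x₀ 1 := fun x hx => hsub ⟨hx.1, hx.2.trans hy.2⟩
  have hEmono : MonotoneOn E (Icc x₀ y) := by
    refine monotoneOn_of_hasDerivWithinAt_nonneg (convex_Icc _ _)
      (fun x hx => (hE x (hsub' hx)).continuousAt.continuousWithinAt)
      (fun x hx => (hE x (hsub' (interior_subset hx))).hasDerivWithinAt) fun x hx => ?_
    rw [interior_Icc] at hx
    exact hE' x (hsub' ⟨hx.1.le, hx.2.le⟩) (hpos x ⟨hx.1.le, hx.2⟩).le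
  have hDmono : MonotoneOn D (Icc x₀ y) := by
    refine monotoneOn_of_hasDerivWithinAt_nonneg (convex_Icc _ _)
      (fun x hx => (hD x (hsub' hx)).continuousAt.continuousWithinAt)
      (fun x hx => (hD x (hsub' (interior_subset hx))).hasDerivWithinAt) fun x hx => ?_
    rw [interior_Icc] at hx
    have := hEmono ⟨le_rfl, hy.1⟩ ⟨hx.1.le, hx.2.le⟩ hx.1.le
    exact div_nonneg (hE₀.le.trans this) (hx₀.trans hx.1).le
  exact absurd (hDmono ⟨le_rfl, hy.1⟩ ⟨hy.1, le_rfl⟩ hy.1) (not_le.2 (lt_of_le_of_lt hDy hD₀))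

theorem hasDerivAt_one_sub_rpow {b x : ℝ} (hx : x < 1) :
    HasDerivAt (fun y : ℝ => (1 - y) ^ (-b)) (b * (1 - x) ^ (-b - 1)) x := by
  have h := ((hasDerivAt_id x).const_sub 1).rpow_const (p := -b) (Or.inl (by simp; linarith))
  convert! h using 1
  simp

/-- The series on the left of `h` is `(x J')'`, where `J` is the sum of `c n * x ^ n`. Thus `h` is a
second order differential inequality for `J`, whose solutions are dominated near `1` by multiples of
the supersolution `(1 - x) ^ (-a)`. -/
theorem exists_tsum_le_one_sub_rpow {c : ℕ → ℝ} (hc : ∀ n, 0 ≤ c n)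
    (hs : ∀ x ∈ Ico (0 : ℝ) 1, Summable fun n => c n * x ^ n) {K a : ℝ} (hK : 0 ≤ K) (ha : 0 < a)
    (hKa : K < a + a ^ 2)
    (h : ∀ x ∈ Ico (0 : ℝ) 1, ∑' n : ℕ, (n + 1 : ℝ) ^ 2 * c (n + 1) * x ^ n ≤
      K / (1 - x) ^ 2 * ∑' n, c n * x ^ n) :
    ∃ C, 0 ≤ C ∧ ∀ x ∈ Ico (0 : ℝ) 1, ∑' n, c n * x ^ n ≤ C * (1 - x) ^ (-a) := by
  set J : ℝ → ℝ := fun x => ∑' n, c n * x ^ n with hJ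
  set c' : ℕ → ℝ := fun n => n * c n with hc'
  have hc'0 : ∀ n, 0 ≤ c' n := fun n => mul_nonneg n.cast_nonneg (hc n)
  -- `x J'(x)` is again a power series
  have hshift : ∀ n : ℕ, ∀ x : ℝ, c' n * x ^ n = x * (c n * (n * x ^ (n - 1))) := by
    rintro (_ | n) x
    · simp [hc']
    · simp only [hc', Nat.add_sub_cancel]; ring
  have hs' : ∀ x ∈ Ico (0 : ℝ) 1, Summable fun n => c' n * x ^ n := fun x hx => by
    simp_rw [hshift]
    exact (summable_natCast_mul_pow_pred hc hs hx).mul_left x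
  set P : ℝ → ℝ := fun x => ∑' n, c' n * x ^ n with hP
  have hJd : ∀ x ∈ Ioo (0 : ℝ) 1, HasDerivAt J (P x / x) x := fun x hx => by
    have := hasDerivAt_tsum_mul_pow hc hs (Ioo_subset_Ico_self hx)
    convert! this using 1
    simp_rw [hP, hshift, tsum_mul_left]
    exact mul_div_cancel_left₀ _ hx.1.ne'
  have hPd : ∀ x ∈ Ico (0 : ℝ) 1, HasDerivAt P (∑' n : ℕ, (n + 1 : ℝ) ^ 2 * c (n + 1) * x ^ n) x :=
    fun x hx => by
    convert! hasDerivAt_tsum_mul_pow hc'0 hs' hx using 1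
    rw [(summable_natCast_mul_pow_pred hc'0 hs' hx).tsum_eq_zero_add]
    simp only [hc', CharP.cast_eq_zero, zero_mul, zero_add, Nat.add_sub_cancel]
    refine tsum_congr fun n => ?_
    push_cast
    ring
  -- `(1 - x) ^ (-a)` is a supersolution on `[x₀, 1)`
  obtain ⟨x₀, hx₀, hx₀K⟩ : ∃ x₀ ∈ Ioo (0 : ℝ) 1, K ≤ a + a ^ 2 * x₀ := by
    have ha2 : 0 < a ^ 2 := by positivity
    refine ⟨max (1 / 2) ((K - a) / a ^ 2), ⟨by positivity, max_lt (by norm_num) ?_⟩, ?_⟩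
    · rw [div_lt_one ha2]; linarith
    · have := le_max_right (1 / 2) ((K - a) / a ^ 2)
      rw [div_le_iff₀ ha2] at this
      linarith
  have hJ0 : ∀ x ∈ Ico (0 : ℝ) 1, 0 ≤ J x := fun x hx =>
    tsum_nonneg fun n => mul_nonneg (hc n) (pow_nonneg hx.1 n)
  have hP0 : ∀ x ∈ Ico (0 : ℝ) 1, 0 ≤ P x := fun x hx =>
    tsum_nonneg fun n => mul_nonneg (hc'0 n) (pow_nonneg hx.1 n)
  have hV : ∀ {x : ℝ}, x ∈ Ico (0 : ℝ) 1 → 1 ≤ (1 - x) ^ (-a) := fun {x} hx =>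
    Real.one_le_rpow_of_pos_of_le_one_of_nonpos (by linarith [hx.2]) (by linarith [hx.1])
      (by linarith)
  have hx₀' := Ioo_subset_Ico_self hx₀
  set Q : ℝ := x₀ * (a * (1 - x₀) ^ (-a - 1)) with hQ
  have hQ0 : 0 < Q := by
    have : 0 < 1 - x₀ := by linarith [hx₀.2]
    have := hx₀.1
    positivity
  -- large enough for the value and the derivative of `C (1 - x) ^ (-a) - J` to be positive at `x₀`
  set C : ℝ := J x₀ + 1 + (P x₀ + 1) / Q with hC
  have hC1 : J x₀ + 1 ≤ C := by
    have : 0 ≤ (P x₀ + 1) / Q := div_nonneg (by linarith [hP0 x₀ hx₀']) hQ0.le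
    linarith
  have hC0 : 0 ≤ C := by linarith [hJ0 x₀ hx₀']
  refine ⟨C, hC0, fun x hx => ?_⟩
  rcases lt_or_ge x x₀ with hlt | hge
  · calc J x ≤ J x₀ := (hs x hx).tsum_le_tsum (fun n =>
          mul_le_mul_of_nonneg_left (pow_le_pow_left₀ hx.1 hlt.le n) (hc n)) (hs x₀ hx₀')
      _ ≤ C * 1 := by linarith
      _ ≤ C * (1 - x) ^ (-a) := mul_le_mul_of_nonneg_left (hV hx) hC0
  · have key := pos_of_hasDerivAt_div hx₀.1
      (D := fun x => C * (1 - x) ^ (-a) - J x)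
      (E := fun x => C * (x * (a * (1 - x) ^ (-a - 1))) - P x)
      (E' := fun x => C * (1 * (a * (1 - x) ^ (-a - 1)) +
        x * (a * ((a + 1) * (1 - x) ^ (-a - 1 - 1)))) -
        ∑' n : ℕ, (n + 1 : ℝ) ^ 2 * c (n + 1) * x ^ n) ?_ ?_ ?_ ?_ ?_ x ⟨hge, hx.2⟩
    · linarith
    · intro y hy
      have hy0 : 0 < y := hx₀.1.trans_le hy.1
      convert! ((hasDerivAt_one_sub_rpow (b := a) hy.2).const_mul C).sub (hJd y ⟨hy0, hy.2⟩) using 1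
      field_simp
    · intro y hy
      have hy0 : 0 < y := hx₀.1.trans_le hy.1
      have h1 := hasDerivAt_one_sub_rpow (b := a + 1) hy.2
      rw [show -(a + 1) = -a - 1 by ring] at h1
      exact (((hasDerivAt_id y).mul (h1.const_mul a)).const_mul C).sub (hPd y ⟨hy0.le, hy.2⟩)
    · intro y hy hDy
      have hy0 : 0 < y := hx₀.1.trans_le hy.1
      have h1y : 0 < 1 - y := by linarith [hy.2]
      have e1 : (1 - y) ^ (-a - 1) = (1 - y) ^ (-a) / (1 - y) := Real.rpow_sub_one h1y.ne' _
      have e2 : (1 - y) ^ (-a - 1 - 1) = (1 - y) ^ (-a) / (1 - y) / (1 - y) := by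
        rw [Real.rpow_sub_one h1y.ne', e1]
      have hle := h y ⟨hy0.le, hy.2⟩
      have hk : 0 ≤ K / (1 - y) ^ 2 := by positivity
      have h2 : K / (1 - y) ^ 2 * J y ≤ K / (1 - y) ^ 2 * (C * (1 - y) ^ (-a)) :=
        mul_le_mul_of_nonneg_left (by linarith) hk
      have hV0 : 0 < (1 - y) ^ (-a) := Real.rpow_pos_of_pos h1y _
      have h3 : K / (1 - y) ^ 2 * (C * (1 - y) ^ (-a)) ≤
          C * (1 * (a * (1 - y) ^ (-a - 1)) + y * (a * ((a + 1) * (1 - y) ^ (-a - 1 - 1)))) := by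
        rw [e1, e2]
        have : C * (1 * (a * ((1 - y) ^ (-a) / (1 - y))) +
            y * (a * ((a + 1) * ((1 - y) ^ (-a) / (1 - y) / (1 - y))))) =
            (a + a ^ 2 * y) / (1 - y) ^ 2 * (C * (1 - y) ^ (-a)) := by
          field_simp
          ring
        rw [this]
        have : K ≤ a + a ^ 2 * y := hx₀K.trans (by gcongr; exact hy.1)
        gcongr
      linarith
    · have := mul_le_mul_of_nonneg_left (hV hx₀') hC0
      linarith
    · have : (P x₀ + 1) / Q * Q = P x₀ + 1 := div_mul_cancel₀ _ hQ0.ne'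
      have h4 : (P x₀ + 1) / Q ≤ C := by linarith [hJ0 x₀ hx₀']
      have := mul_le_mul_of_nonneg_right h4 hQ0.le
      linarith

/-! ### Parseval's identity and square means of analytic functions -/

/-- Parseval's identity for an absolutely convergent power series on the unit circle. -/
theorem integral_norm_tsum_mul_exp_sq {b : ℕ → ℂ} (hb : Summable fun n => ‖b n‖) :
    ∫ θ in (0 : ℝ)..(2 * Real.pi), ‖∑' n, b n * Complex.exp (θ * Complex.I) ^ n‖ ^ 2 =
      2 * Real.pi * ∑' n, ‖b n‖ ^ 2 := by
  -- Parseval's identity holds for the partial sums `S N`, and dominated convergence gives the limit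
  set S : ℕ → ℝ → ℂ := fun N θ => ∑ n ∈ Finset.range N, b n * Complex.exp (θ * Complex.I) ^ n
  have hnorm : ∀ (θ : ℝ) n, ‖b n * Complex.exp (θ * Complex.I) ^ n‖ = ‖b n‖ := fun θ n => by
    rw [norm_mul, norm_pow, Complex.norm_exp_ofReal_mul_I, one_pow, mul_one]
  have hpoly : ∀ N, ∫ θ in (0 : ℝ)..(2 * Real.pi), ‖S N θ‖ ^ 2 =
      2 * Real.pi * ∑ n ∈ Finset.range N, ‖b n‖ ^ 2 := by
    intro N
    set q : Polynomial ℂ := ∑ n ∈ Finset.range N, Polynomial.monomial n (b n) with hq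
    have hcoeff : ∀ n, q.coeff n = if n < N then b n else 0 := fun n => by
      simp [hq, Polynomial.finsetSum_coeff, Polynomial.coeff_monomial]
    have heval : ∀ θ : ℝ, q.eval (circleMap 0 1 θ) = S N θ := fun θ => by
      simp [hq, S, Polynomial.eval_finsetSum, circleMap]
    have := q.sum_sq_norm_coeff_eq_circleAverage
    simp_rw [Real.circleAverage_def, heval, smul_eq_mul] at this
    rw [show ∑ n ∈ Finset.range N, ‖b n‖ ^ 2 = ∑ n ∈ q.support, ‖q.coeff n‖ ^ 2 from ?_, this]
    · field_simp
    · symm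
      have hsub : q.support ⊆ Finset.range N := fun n hn => by
        rw [Polynomial.mem_support_iff, hcoeff] at hn
        simpa using fun h => hn (if_neg h)
      rw [Finset.sum_subset hsub fun n _ hn => by
        rw [Polynomial.notMem_support_iff.1 hn]; simp]
      exact Finset.sum_congr rfl fun n hn => by rw [hcoeff, if_pos (Finset.mem_range.1 hn)]
  have hsq : Summable fun n => ‖b n‖ ^ 2 := by
    refine Summable.of_nonneg_of_le (fun n => by positivity) (fun n => ?_)
      (hb.mul_left (∑' n, ‖b n‖))
    rw [sq]
    exact mul_le_mul_of_nonneg_right (hb.le_tsum n fun _ _ => norm_nonneg _) (norm_nonneg _)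
  have hlim1 : Filter.Tendsto (fun N => ∫ θ in (0 : ℝ)..(2 * Real.pi), ‖S N θ‖ ^ 2) Filter.atTop
      (nhds (2 * Real.pi * ∑' n, ‖b n‖ ^ 2)) := by
    simp_rw [hpoly]
    exact hsq.hasSum.tendsto_sum_nat.const_mul _
  refine tendsto_nhds_unique ?_ hlim1
  refine intervalIntegral.tendsto_integral_filter_of_dominated_convergence
    (fun _ => (∑' n, ‖b n‖) ^ 2) (Filter.Eventually.of_forall fun N => ?_)
    (Filter.Eventually.of_forall fun N => Filter.Eventually.of_forall fun θ _ => ?_)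
    intervalIntegrable_const (Filter.Eventually.of_forall fun θ _ => ?_)
  · exact Continuous.aestronglyMeasurable (by simp only [S]; fun_prop)
  · rw [Real.norm_of_nonneg (by positivity)]
    refine pow_le_pow_left₀ (norm_nonneg _) ((norm_sum_le _ _).trans ?_) 2
    simp_rw [hnorm]
    exact hb.sum_le_tsum _ fun _ _ => norm_nonneg _
  · have : Summable fun n => b n * Complex.exp (θ * Complex.I) ^ n :=
      .of_norm (by simpa only [hnorm] using hb)
    exact (this.hasSum.tendsto_sum_nat.norm).pow 2

theorem ofReal_mul_exp_mem_ball {r : ℝ} (hr : r ∈ Ico (0 : ℝ) 1) (θ : ℝ) :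
    (r : ℂ) * Complex.exp (θ * Complex.I) ∈ ball (0 : ℂ) 1 := by
  rw [mem_ball_zero_iff, norm_mul, Complex.norm_exp_ofReal_mul_I, Complex.norm_real,
    Real.norm_of_nonneg hr.1, mul_one]
  exact hr.2

theorem continuous_comp_circle {E : Type*} [TopologicalSpace E] {f : ℂ → E}
    (hf : ContinuousOn f (ball 0 1)) {r : ℝ} (hr : r ∈ Ico (0 : ℝ) 1) :
    Continuous fun θ : ℝ => f (r * Complex.exp (θ * Complex.I)) :=
  hf.comp_continuous (by fun_prop) fun θ => ofReal_mul_exp_mem_ball hr θ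

/-- The `n`-th Taylor coefficient of `φ` at the origin, through the iterated derivative. -/
noncomputable def taylorCoeff (φ : ℂ → ℂ) (n : ℕ) : ℂ :=
  (n.factorial : ℂ)⁻¹ * iteratedDeriv n φ 0

theorem taylorCoeff_deriv (φ : ℂ → ℂ) (n : ℕ) :
    taylorCoeff (deriv φ) n = (n + 1) * taylorCoeff φ (n + 1) := by
  have : (n + 1 : ℂ) ≠ 0 := by exact_mod_cast n.succ_ne_zero
  rw [taylorCoeff, taylorCoeff, iteratedDeriv_succ', Nat.factorial_succ]
  push_cast
  field_simp

theorem hasSum_taylorCoeff {φ : ℂ → ℂ} (hφ : DifferentiableOn ℂ φ (ball 0 1)) {z : ℂ}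
    (hz : z ∈ ball (0 : ℂ) 1) : HasSum (fun n => taylorCoeff φ n * z ^ n) (φ z) := by
  convert! Complex.hasSum_taylorSeries_on_ball hφ hz using 2 with n
  simp only [taylorCoeff, smul_eq_mul, sub_zero]
  ring

theorem summable_norm_taylorCoeff {φ : ℂ → ℂ} (hφ : DifferentiableOn ℂ φ (ball 0 1)) {r : ℝ}
    (hr : r ∈ Ico (0 : ℝ) 1) : Summable fun n => ‖taylorCoeff φ n * (r : ℂ) ^ n‖ :=
  (hasSum_taylorCoeff hφ (by simpa using ofReal_mul_exp_mem_ball hr 0)).summable.norm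

/-- Parseval's identity on the circle of radius `r`; the right side is a power series in `r ^ 2`. -/
theorem integral_norm_sq_circle {φ : ℂ → ℂ} (hφ : DifferentiableOn ℂ φ (ball 0 1)) {r : ℝ}
    (hr : r ∈ Ico (0 : ℝ) 1) :
    ∫ θ in (0 : ℝ)..(2 * Real.pi), ‖φ (r * Complex.exp (θ * Complex.I))‖ ^ 2 =
      2 * Real.pi * ∑' n, ‖taylorCoeff φ n‖ ^ 2 * (r ^ 2) ^ n := by
  have h := integral_norm_tsum_mul_exp_sq (summable_norm_taylorCoeff hφ hr)
  have hcoeff : ∀ n, ‖taylorCoeff φ n * (r : ℂ) ^ n‖ ^ 2 = ‖taylorCoeff φ n‖ ^ 2 * (r ^ 2) ^ n :=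
    fun n => by
      rw [norm_mul, norm_pow, Complex.norm_real, Real.norm_of_nonneg hr.1]
      ring
  simp_rw [hcoeff] at h
  rw [← h]
  refine intervalIntegral.integral_congr fun θ _ => ?_
  simp only [← (hasSum_taylorCoeff hφ (ofReal_mul_exp_mem_ball hr θ)).tsum_eq, mul_pow, mul_assoc]

theorem summable_norm_sq_taylorCoeff {φ : ℂ → ℂ} (hφ : DifferentiableOn ℂ φ (ball 0 1)) {x : ℝ}
    (hx : x ∈ Ico (0 : ℝ) 1) : Summable fun n => ‖taylorCoeff φ n‖ ^ 2 * x ^ n := by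
  have hr : √x ∈ Ico (0 : ℝ) 1 := ⟨Real.sqrt_nonneg x, by
    rw [Real.sqrt_lt' one_pos]; simpa using hx.2⟩
  have hb := summable_norm_taylorCoeff hφ hr
  refine Summable.of_nonneg_of_le (fun n => mul_nonneg (by positivity) (pow_nonneg hx.1 n))
    (fun n => ?_) (hb.mul_left (∑' n, ‖taylorCoeff φ n * (√x : ℂ) ^ n‖))
  calc ‖taylorCoeff φ n‖ ^ 2 * x ^ n = ‖taylorCoeff φ n * (√x : ℂ) ^ n‖ ^ 2 := by
        rw [norm_mul, norm_pow, Complex.norm_real, Real.norm_of_nonneg hr.1, mul_pow, ← pow_mul,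
          mul_comm n, pow_mul, Real.sq_sqrt hx.1]
    _ ≤ _ := by
        rw [sq]
        exact mul_le_mul_of_nonneg_right (hb.le_tsum n fun _ _ => norm_nonneg _) (norm_nonneg _)

/-- A function with `|φ'| ≤ m |φ| / (1 - |z|²)` has square means of order `(1 - r) ^ (-a)` whenever
`a + a ^ 2 > m ^ 2`. -/
theorem exists_integral_norm_sq_le {φ : ℂ → ℂ} (hφ : DifferentiableOn ℂ φ (ball 0 1)) {m a : ℝ}
    (hm : ∀ z ∈ ball (0 : ℂ) 1, ‖deriv φ z‖ ≤ m / (1 - ‖z‖ ^ 2) * ‖φ z‖) (ha : 0 < a)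
    (hma : m ^ 2 < a + a ^ 2) :
    ∃ C, 0 ≤ C ∧ ∀ r ∈ Ico (0 : ℝ) 1,
      ∫ θ in (0 : ℝ)..(2 * Real.pi), ‖φ (r * Complex.exp (θ * Complex.I))‖ ^ 2 ≤
        C * (1 - r) ^ (-a) := by
  have hφ' : DifferentiableOn ℂ (deriv φ) (ball 0 1) := hφ.deriv isOpen_ball
  have hpi := Real.two_pi_pos
  -- Parseval turns the pointwise bound on `φ'` into an inequality between power series
  have hode : ∀ x ∈ Ico (0 : ℝ) 1,
      ∑' n : ℕ, (n + 1 : ℝ) ^ 2 * ‖taylorCoeff φ (n + 1)‖ ^ 2 * x ^ n ≤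
        m ^ 2 / (1 - x) ^ 2 * ∑' n, ‖taylorCoeff φ n‖ ^ 2 * x ^ n := by
    intro x hx
    have hr : √x ∈ Ico (0 : ℝ) 1 := ⟨Real.sqrt_nonneg x, by
      rw [Real.sqrt_lt' one_pos]; simpa using hx.2⟩
    have h1 := integral_norm_sq_circle hφ hr
    have h2 := integral_norm_sq_circle hφ' hr
    rw [Real.sq_sqrt hx.1] at h1 h2
    have h3 : ∀ n : ℕ, ‖taylorCoeff (deriv φ) n‖ ^ 2 * x ^ n =
        (n + 1 : ℝ) ^ 2 * ‖taylorCoeff φ (n + 1)‖ ^ 2 * x ^ n := fun n => by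
      rw [taylorCoeff_deriv, norm_mul, mul_pow]
      norm_cast
    simp_rw [h3] at h2
    refine le_of_mul_le_mul_left ?_ hpi
    rw [← h2, mul_left_comm, ← h1, ← intervalIntegral.integral_const_mul]
    refine intervalIntegral.integral_mono_on hpi.le ?_ ?_ fun θ _ => ?_
    · exact ((continuous_comp_circle hφ'.continuousOn hr).norm.pow 2).intervalIntegrable _ _
    · exact (((continuous_comp_circle hφ.continuousOn hr).norm.pow 2).const_mul _
        ).intervalIntegrable _ _
    · have h4 := hm _ (ofReal_mul_exp_mem_ball hr θ)
      rw [norm_mul (√x : ℂ), Complex.norm_exp_ofReal_mul_I, Complex.norm_real,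
        Real.norm_of_nonneg hr.1, mul_one, Real.sq_sqrt hx.1] at h4
      calc _ ≤ _ := pow_le_pow_left₀ (norm_nonneg _) h4 2
        _ = _ := by rw [mul_pow, div_pow]
  obtain ⟨C, hC0, hC⟩ := exists_tsum_le_one_sub_rpow (c := fun n => ‖taylorCoeff φ n‖ ^ 2)
    (fun n => by positivity) (fun x hx => summable_norm_sq_taylorCoeff hφ hx)
    (sq_nonneg m) ha hma hode
  refine ⟨2 * Real.pi * C, by positivity, fun r hr => ?_⟩
  have hr2 : r ^ 2 ≤ r := by nlinarith [hr.1, hr.2]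
  have h1r : 0 < 1 - r := by linarith [hr.2]
  rw [integral_norm_sq_circle hφ hr, mul_assoc (2 * Real.pi)]
  refine mul_le_mul_of_nonneg_left ((hC _ ⟨sq_nonneg r, by linarith⟩).trans ?_) hpi.le
  refine mul_le_mul_of_nonneg_left ?_ hC0
  exact Real.rpow_le_rpow_of_nonpos h1r (by linarith) (by linarith)

/-- A substitute for Minkowski's inequality (`1 ≤ p`) and for subadditivity of the power (`p ≤ 1`)
that treats every `p > 0` at once: the weighted sum is at most `(1 - q)⁻¹` times the largest term. -/
theorem sum_geometric_mul_rpow_le {q p : ℝ} (hq : 0 < q) (hq1 : q < 1) (hp : 0 < p) {y : ℕ → ℝ}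
    (hy : ∀ n, 0 ≤ y n) (N : ℕ) :
    (∑ k ∈ Finset.range N, q ^ k * y k) ^ p ≤
      ((1 - q)⁻¹) ^ p * ∑ k ∈ Finset.range N, y k ^ p := by
  rcases N.eq_zero_or_pos with rfl | hN
  · simp [Real.zero_rpow hp.ne']
  have h1q : 0 < 1 - q := by linarith
  obtain ⟨j, hj, hmax⟩ := Finset.exists_max_image (Finset.range N) y ⟨0, Finset.mem_range.2 hN⟩
  calc (∑ k ∈ Finset.range N, q ^ k * y k) ^ p
      ≤ ((1 - q)⁻¹ * y j) ^ p := by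
        refine Real.rpow_le_rpow (Finset.sum_nonneg fun k _ => mul_nonneg (by positivity) (hy k))
          ?_ hp.le
        calc _ ≤ ∑ k ∈ Finset.range N, q ^ k * y j :=
              Finset.sum_le_sum fun k hk => mul_le_mul_of_nonneg_left (hmax k hk) (by positivity)
          _ = (∑ k ∈ Finset.range N, q ^ k) * y j := by rw [Finset.sum_mul]
          _ ≤ _ := by
              refine mul_le_mul_of_nonneg_right ?_ (hy j)
              rw [← tsum_geometric_of_lt_one hq.le hq1]
              exact (summable_geometric_of_lt_one hq.le hq1).sum_le_tsum _ fun _ _ => by positivity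
    _ = ((1 - q)⁻¹) ^ p * y j ^ p := Real.mul_rpow (by positivity) (hy j)
    _ ≤ _ := by
        refine mul_le_mul_of_nonneg_left ?_ (by positivity)
        exact Finset.single_le_sum (f := fun k => y k ^ p)
          (fun k _ => Real.rpow_nonneg (hy k) p) hj

theorem exists_lt_sq_lt_add_sq {p lam : ℝ} (hp : 0 < p) (h : p * (lam ^ 2 - 1) < 1) :
    ∃ a, 0 < a ∧ a < p ∧ (p * lam) ^ 2 < a + a ^ 2 := by
  have hlt : (p * lam) ^ 2 < p + p ^ 2 := by nlinarith
  have hcont : Continuous fun a : ℝ => a + a ^ 2 := by fun_prop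
  have h1 : ∀ᶠ a in nhdsWithin p (Iio p), (p * lam) ^ 2 < a + a ^ 2 :=
    (hcont.tendsto p).eventually_const_lt hlt |>.filter_mono nhdsWithin_le_nhds
  have h2 : ∀ᶠ a in nhdsWithin p (Iio p), 0 < a :=
    (eventually_gt_nhds hp).filter_mono nhdsWithin_le_nhds
  obtain ⟨a, ha1, ha2, ha3⟩ := (h1.and (h2.and self_mem_nhdsWithin)).exists
  exact ⟨a, ha2, ha3, ha1⟩

/-! ### From means of the derivative to means of the function -/

section Radial

variable {F G G' : ℂ → ℂ} {M : ℝ} {u : ℂ}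

theorem ofReal_mul_mem_ball (hu : ‖u‖ = 1) {t : ℝ} (ht : t ∈ Ico (0 : ℝ) 1) :
    (t : ℂ) * u ∈ ball (0 : ℂ) 1 := by
  rw [mem_ball_zero_iff, norm_mul, hu, Complex.norm_real, Real.norm_of_nonneg ht.1, mul_one]
  exact ht.2

theorem hasDerivAt_comp_ofReal_mul {f : ℂ → ℂ} {f' : ℂ} {t : ℝ}
    (hf : HasDerivAt f f' (t * u)) : HasDerivAt (fun s : ℝ => f (s * u)) (f' * u) t := by
  have h : HasDerivAt (fun s : ℂ => s * u) u (t : ℂ) := by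
    simpa using (hasDerivAt_id (t : ℂ)).mul_const u
  exact (hf.comp (t : ℂ) h).comp_ofReal

/-- Harnack inequality for `|exp G|` on a radial segment covering half of the distance to the unit
circle. There `1 - t²` is at least the length of the segment, so `G` varies by at most `M`. -/
theorem norm_exp_radial_le (hu : ‖u‖ = 1) (hM : 0 ≤ M)
    (hG : ∀ z ∈ ball (0 : ℂ) 1, HasDerivAt G (G' z) z)
    (hG' : ∀ z ∈ ball (0 : ℂ) 1, ‖G' z‖ ≤ M / (1 - ‖z‖ ^ 2)) {r : ℝ} (hr : r ∈ Ico (0 : ℝ) 1)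
    {s : ℝ} (hs : s ∈ Icc r (r + (1 - r) / 2)) :
    ‖Complex.exp (G (s * u))‖ ≤ Real.exp M * ‖Complex.exp (G (r * u))‖ := by
  have hd : 0 < (1 - r) / 2 := by linarith [hr.2]
  have hmem : ∀ t ∈ Icc r (r + (1 - r) / 2), t ∈ Ico (0 : ℝ) 1 := fun t ht =>
    ⟨hr.1.trans ht.1, by linarith [ht.2]⟩
  have hderiv : ∀ t ∈ Ico r (r + (1 - r) / 2), ‖G' (t * u) * u‖ ≤ M / ((1 - r) / 2) :=
    fun t ht => by
      have ht' := hmem t ⟨ht.1, ht.2.le⟩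
      rw [norm_mul, hu, mul_one]
      refine (hG' _ (ofReal_mul_mem_ball hu ht')).trans ?_
      rw [norm_mul, hu, Complex.norm_real, Real.norm_of_nonneg ht'.1, mul_one]
      have : t ^ 2 ≤ t := by nlinarith [ht'.1, ht'.2]
      exact div_le_div_of_nonneg_left hM hd (by linarith [ht.2])
  have hle := norm_image_sub_le_of_norm_deriv_le_segment' (f := fun t : ℝ => G (t * u))
    (fun t ht => (hasDerivAt_comp_ofReal_mul
      (hG _ (ofReal_mul_mem_ball hu (hmem t ht)))).hasDerivWithinAt) hderiv s hs
  have h1 : ‖G (s * u) - G (r * u)‖ ≤ M := by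
    refine hle.trans ?_
    rw [div_mul_eq_mul_div, div_le_iff₀ hd]
    exact mul_le_mul_of_nonneg_left (by linarith [hs.2]) hM
  rw [Complex.norm_exp, Complex.norm_exp, ← Real.exp_add, Real.exp_le_exp]
  have h2 := (Complex.abs_re_le_norm _).trans h1
  rw [Complex.sub_re] at h2
  linarith [le_abs_self ((G (s * u)).re - (G (r * u)).re)]

/-- Integration of `F' = exp G` along a radius, one dyadic segment at a time. -/
theorem norm_radial_le_sum_dyadic (hu : ‖u‖ = 1) (hM : 0 ≤ M) (hF0 : F 0 = 0)
    (hF : ∀ z ∈ ball (0 : ℂ) 1, HasDerivAt F (Complex.exp (G z)) z)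
    (hG : ∀ z ∈ ball (0 : ℂ) 1, HasDerivAt G (G' z) z)
    (hG' : ∀ z ∈ ball (0 : ℂ) 1, ‖G' z‖ ≤ M / (1 - ‖z‖ ^ 2)) (N : ℕ) :
    ∀ s ∈ Icc (0 : ℝ) (1 - (1 / 2) ^ N), ‖F (s * u)‖ ≤
      Real.exp M * ∑ k ∈ Finset.range N,
        (1 / 2) ^ k * ‖Complex.exp (G ((1 - (1 / 2) ^ k : ℝ) * u))‖ := by
  induction N with
  | zero =>
    intro s hs
    have : s = 0 := le_antisymm (by simpa using hs.2) hs.1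
    simp [this, hF0]
  | succ N ih =>
    intro s hs
    have hpow : (0 : ℝ) < (1 / 2) ^ N := by positivity
    have hpow1 : (1 / 2 : ℝ) ^ N ≤ 1 := pow_le_one₀ (by norm_num) (by norm_num)
    rw [Finset.sum_range_succ, mul_add]
    set r : ℝ := 1 - (1 / 2) ^ N with hrdef
    rcases le_total s r with hsr | hsr
    · exact (ih s ⟨hs.1, hsr⟩).trans (le_add_of_nonneg_right (by positivity))
    have hr : r ∈ Ico (0 : ℝ) 1 := ⟨by linarith, by linarith⟩
    have hsI : s ∈ Icc r (r + (1 - r) / 2) := ⟨hsr, by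
      have := hs.2
      rw [pow_succ] at this
      linarith⟩
    have hmem : ∀ t ∈ Icc r (r + (1 - r) / 2), t ∈ Ico (0 : ℝ) 1 := fun t ht =>
      ⟨hr.1.trans ht.1, by linarith [ht.2]⟩
    have hle := norm_image_sub_le_of_norm_deriv_le_segment' (f := fun t : ℝ => F (t * u))
      (C := Real.exp M * ‖Complex.exp (G (r * u))‖)
      (fun t ht => (hasDerivAt_comp_ofReal_mul
        (hF _ (ofReal_mul_mem_ball hu (hmem t ht)))).hasDerivWithinAt) (fun t ht => by
          rw [norm_mul, hu, mul_one]
          exact norm_exp_radial_le hu hM hG hG' hr ⟨ht.1, ht.2.le⟩) s hsI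
    have h1 := ih r ⟨hr.1, le_rfl⟩
    have h2 : Real.exp M * ‖Complex.exp (G (r * u))‖ * (s - r) ≤
        Real.exp M * ((1 / 2) ^ N * ‖Complex.exp (G (r * u))‖) := by
      rw [mul_comm ((1 / 2 : ℝ) ^ N), ← mul_assoc]
      exact mul_le_mul_of_nonneg_left (by linarith [hsI.2]) (by positivity)
    have h3 := norm_le_norm_add_norm_sub' (F (s * u)) (F (r * u))
    linarith

end Radial

/-- Growth of the `p`-means of `F' = exp G`, obtained from the square means of `exp (p G / 2)`. -/
theorem exists_integral_norm_exp_rpow_le {G G' : ℂ → ℂ} {lam p a : ℝ} (hp : 0 < p)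
    (hG : ∀ z ∈ ball (0 : ℂ) 1, HasDerivAt G (G' z) z)
    (hG' : ∀ z ∈ ball (0 : ℂ) 1, ‖G' z‖ ≤ 2 * lam / (1 - ‖z‖ ^ 2)) (ha : 0 < a)
    (hpa : (p * lam) ^ 2 < a + a ^ 2) :
    ∃ C, 0 ≤ C ∧ ∀ r ∈ Ico (0 : ℝ) 1,
      ∫ θ in (0 : ℝ)..(2 * Real.pi), ‖Complex.exp (G (r * Complex.exp (θ * Complex.I)))‖ ^ p ≤
        C * (1 - r) ^ (-a) := by
  have hφ : ∀ z ∈ ball (0 : ℂ) 1, HasDerivAt (fun z => Complex.exp ((p / 2 : ℝ) * G z))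
      (Complex.exp ((p / 2 : ℝ) * G z) * ((p / 2 : ℝ) * G' z)) z := fun z hz =>
    ((hG z hz).const_mul _).cexp
  have hm : ∀ z ∈ ball (0 : ℂ) 1, ‖deriv (fun z => Complex.exp ((p / 2 : ℝ) * G z)) z‖ ≤
      p * lam / (1 - ‖z‖ ^ 2) * ‖Complex.exp ((p / 2 : ℝ) * G z)‖ := fun z hz => by
    rw [(hφ z hz).deriv, norm_mul, norm_mul, mul_comm, Complex.norm_real,
      Real.norm_of_nonneg (by positivity)]
    refine mul_le_mul_of_nonneg_right ?_ (norm_nonneg _)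
    calc p / 2 * ‖G' z‖ ≤ p / 2 * (2 * lam / (1 - ‖z‖ ^ 2)) :=
          mul_le_mul_of_nonneg_left (hG' z hz) (by positivity)
      _ = p * lam / (1 - ‖z‖ ^ 2) := by ring
  obtain ⟨C, hC0, hC⟩ := exists_integral_norm_sq_le
    (fun z hz => (hφ z hz).differentiableAt.differentiableWithinAt) hm ha hpa
  refine ⟨C, hC0, fun r hr => ?_⟩
  convert hC r hr using 4 with θ
  rw [Complex.norm_exp, Complex.norm_exp, ← Real.exp_mul, ← Real.exp_nat_mul,
    Complex.re_ofReal_mul]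
  congr 1
  push_cast
  ring

/-- Bounded `p`-means for a primitive `F` of `exp G`, where `G` is a Bloch function of norm at most
`2 * lam`. -/
theorem exists_integral_norm_rpow_le {F G G' : ℂ → ℂ} {lam p : ℝ} (hlam : 0 ≤ lam) (hp : 0 < p)
    (hplam : p * (lam ^ 2 - 1) < 1) (hF0 : F 0 = 0)
    (hF : ∀ z ∈ ball (0 : ℂ) 1, HasDerivAt F (Complex.exp (G z)) z)
    (hG : ∀ z ∈ ball (0 : ℂ) 1, HasDerivAt G (G' z) z)
    (hG' : ∀ z ∈ ball (0 : ℂ) 1, ‖G' z‖ ≤ 2 * lam / (1 - ‖z‖ ^ 2)) :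
    ∃ C, ∀ r ∈ Ioo (0 : ℝ) 1,
      ∫ θ in (0 : ℝ)..(2 * Real.pi), ‖F (r * Complex.exp (θ * Complex.I))‖ ^ p ≤ C := by
  obtain ⟨a, ha, hap, hpa⟩ := exists_lt_sq_lt_add_sq hp hplam
  obtain ⟨C, hC0, hC⟩ := exists_integral_norm_exp_rpow_le hp hG hG' ha hpa
  -- `q` is the geometric factor given up; `δ` is small enough that `w ^ p * 2 ^ a = t < 1`
  set δ : ℝ := (p - a) / (2 * p) with hδ
  have hδ0 : 0 < δ := div_pos (by linarith) (by linarith)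
  set q : ℝ := 2 ^ (-δ) with hq
  set w : ℝ := 2 ^ (δ - 1) with hw
  set t : ℝ := 2 ^ ((a - p) / 2) with ht
  have hq0 : 0 < q := by positivity
  have hw0 : 0 < w := by positivity
  have ht0 : 0 < t := by positivity
  have hq1 : q < 1 := Real.rpow_lt_one_of_one_lt_of_neg one_lt_two (by linarith)
  have ht1 : t < 1 := Real.rpow_lt_one_of_one_lt_of_neg one_lt_two (by linarith)
  have hqw : q * w = 1 / 2 := by
    rw [hq, hw, ← Real.rpow_add two_pos, show -δ + (δ - 1) = -1 by ring, Real.rpow_neg_one]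
    norm_num
  have hwt : ∀ k : ℕ, (w ^ k) ^ p * ((1 / 2 : ℝ) ^ k) ^ (-a) = t ^ k := fun k => by
    rw [one_div, ← Real.rpow_neg_one, hw, ht, ← Real.rpow_mul_natCast two_pos.le,
      ← Real.rpow_mul_natCast two_pos.le, ← Real.rpow_mul_natCast two_pos.le,
      ← Real.rpow_mul two_pos.le, ← Real.rpow_mul two_pos.le, ← Real.rpow_add two_pos]
    congr 1
    rw [hδ]
    field_simp
    ring
  have hrk : ∀ k : ℕ, (1 - (1 / 2) ^ k : ℝ) ∈ Ico (0 : ℝ) 1 := fun k =>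
    ⟨by linarith [pow_le_one₀ (n := k) (by norm_num : (0 : ℝ) ≤ 1 / 2) (by norm_num)],
      by linarith [pow_pos (by norm_num : (0 : ℝ) < 1 / 2) k]⟩
  have hGc : ContinuousOn (fun z => Complex.exp (G z)) (ball 0 1) := fun z hz =>
    (hG z hz).continuousAt.cexp.continuousWithinAt
  have hFc : ContinuousOn F (ball 0 1) := fun z hz => (hF z hz).continuousAt.continuousWithinAt
  -- `W k θ` is `|F'|` on the `k`-th dyadic circle
  set W : ℕ → ℝ → ℝ := fun k θ =>
    ‖Complex.exp (G ((1 - (1 / 2) ^ k : ℝ) * Complex.exp (θ * Complex.I)))‖ with hW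
  have hWc : ∀ k, Continuous fun θ => W k θ ^ p := fun k =>
    (continuous_comp_circle hGc (hrk k)).norm.rpow_const fun _ => Or.inr hp.le
  set A : ℝ := Real.exp (2 * lam) ^ p * ((1 - q)⁻¹) ^ p with hA
  have h1q : 0 < 1 - q := by linarith
  have hA0 : 0 ≤ A := by positivity
  have hpt : ∀ (N : ℕ), ∀ r ∈ Icc (0 : ℝ) (1 - (1 / 2) ^ N), ∀ θ : ℝ,
      ‖F (r * Complex.exp (θ * Complex.I))‖ ^ p ≤
        A * ∑ k ∈ Finset.range N, (w ^ k) ^ p * W k θ ^ p := by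
    intro N r hr θ
    have h1 := norm_radial_le_sum_dyadic (Complex.norm_exp_ofReal_mul_I θ)
      (mul_nonneg two_pos.le hlam) hF0 hF hG hG' N r hr
    have h2 := sum_geometric_mul_rpow_le hq0 hq1 hp (y := fun k => w ^ k * W k θ)
      (fun k => by positivity) N
    simp_rw [← mul_assoc, ← mul_pow, hqw] at h2
    calc ‖F (r * Complex.exp (θ * Complex.I))‖ ^ p
        ≤ (Real.exp (2 * lam) * ∑ k ∈ Finset.range N, (1 / 2) ^ k * W k θ) ^ p :=
          Real.rpow_le_rpow (norm_nonneg _) h1 hp.le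
      _ = Real.exp (2 * lam) ^ p * (∑ k ∈ Finset.range N, (1 / 2) ^ k * W k θ) ^ p :=
          Real.mul_rpow (by positivity) (Finset.sum_nonneg fun k _ => by positivity)
      _ ≤ Real.exp (2 * lam) ^ p * (((1 - q)⁻¹) ^ p *
            ∑ k ∈ Finset.range N, (w ^ k * W k θ) ^ p) :=
          mul_le_mul_of_nonneg_left h2 (by positivity)
      _ = _ := by
          rw [hA, mul_assoc]
          congr 3
          exact funext fun k => Real.mul_rpow (by positivity) (norm_nonneg _)
  refine ⟨A * (C * (1 - t)⁻¹), fun r hr => ?_⟩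
  obtain ⟨N, hN⟩ := exists_pow_lt_of_lt_one (show (0 : ℝ) < 1 - r by linarith [hr.2])
    (show (1 / 2 : ℝ) < 1 by norm_num)
  calc _ ≤ ∫ θ in (0 : ℝ)..(2 * Real.pi), A * ∑ k ∈ Finset.range N, (w ^ k) ^ p * W k θ ^ p := by
        refine intervalIntegral.integral_mono_on Real.two_pi_pos.le ?_ ?_
          fun θ _ => hpt N r ⟨hr.1.le, by linarith⟩ θ
        · exact ((continuous_comp_circle hFc (Ioo_subset_Ico_self hr)).norm.rpow_const
            fun _ => Or.inr hp.le).intervalIntegrable _ _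
        · exact ((continuous_finsetSum _ fun k _ => (hWc k).const_mul _).const_mul
            A).intervalIntegrable _ _
    _ = A * ∑ k ∈ Finset.range N, (w ^ k) ^ p * ∫ θ in (0 : ℝ)..(2 * Real.pi), W k θ ^ p := by
        rw [intervalIntegral.integral_const_mul, intervalIntegral.integral_finsetSum
          fun k _ => ((hWc k).const_mul _).intervalIntegrable _ _]
        simp_rw [intervalIntegral.integral_const_mul]
    _ ≤ A * ∑ k ∈ Finset.range N, C * t ^ k := by
        refine mul_le_mul_of_nonneg_left (Finset.sum_le_sum fun k _ => ?_) hA0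
        have := hC _ (hrk k)
        rw [sub_sub_cancel] at this
        calc _ ≤ (w ^ k) ^ p * (C * ((1 / 2 : ℝ) ^ k) ^ (-a)) :=
              mul_le_mul_of_nonneg_left this (by positivity)
          _ = C * t ^ k := by rw [← hwt k]; ring
    _ ≤ A * (C * (1 - t)⁻¹) := by
        rw [← Finset.mul_sum, ← tsum_geometric_of_lt_one ht0.le ht1]
        refine mul_le_mul_of_nonneg_left (mul_le_mul_of_nonneg_left ?_ hC0) hA0
        exact (summable_geometric_of_lt_one ht0.le ht1).sum_le_tsum _ fun _ _ => by positivity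

/-! ### Pre-Schwarzian bounds for analytic functions and harmonic mappings -/

/-- The analytic case: a locally univalent `F` whose pre-Schwarzian norm is at most `2 * lam` belongs
to the Hardy space `H^p`. -/
theorem exists_integral_norm_rpow_le_of_preSchwarzian {F : ℂ → ℂ} {lam p : ℝ} (hlam : 0 ≤ lam)
    (hp : 0 < p) (hplam : p * (lam ^ 2 - 1) < 1) (hF : DifferentiableOn ℂ F (ball 0 1))
    (hF0 : F 0 = 0) (hF' : ∀ z ∈ ball (0 : ℂ) 1, deriv F z ≠ 0)
    (hT : ∀ z ∈ ball (0 : ℂ) 1, (1 - ‖z‖ ^ 2) * ‖deriv (deriv F) z / deriv F z‖ ≤ 2 * lam) :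
    ∃ C, ∀ r ∈ Ioo (0 : ℝ) 1,
      ∫ θ in (0 : ℝ)..(2 * Real.pi), ‖F (r * Complex.exp (θ * Complex.I))‖ ^ p ≤ C := by
  have hF1 : DifferentiableOn ℂ (deriv F) (ball 0 1) := hF.deriv isOpen_ball
  have hF2 : DifferentiableOn ℂ (deriv (deriv F)) (ball 0 1) := hF1.deriv isOpen_ball
  have h0 : (0 : ℂ) ∈ ball (0 : ℂ) 1 := mem_ball_self one_pos
  -- a holomorphic branch `G` of `log F'`
  obtain ⟨G, hG0, hG⟩ := ((hF2.div hF1 hF').isExactOn_ball).with_val_at 0 (Complex.log (deriv F 0))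
  -- `F' exp (-G)` has zero derivative and equals `1` at the origin
  have hderiv : ∀ z ∈ ball (0 : ℂ) 1,
      HasDerivAt (fun z => deriv F z * Complex.exp (-G z)) 0 z := fun z hz => by
    have h1 := ((hF1 z hz).differentiableAt (isOpen_ball.mem_nhds hz)).hasDerivAt.mul
      (hG z hz).neg.cexp
    convert! h1 using 1
    have := hF' z hz
    simp only [Pi.div_apply, Pi.neg_apply]
    field_simp
    ring
  have hexp : ∀ z ∈ ball (0 : ℂ) 1, deriv F z = Complex.exp (G z) := fun z hz => by
    have h1 := (convex_ball (0 : ℂ) 1).is_const_of_fderivWithin_eq_zero (𝕜 := ℂ)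
      (f := fun z => deriv F z * Complex.exp (-G z))
      (fun z hz => (hderiv z hz).differentiableAt.differentiableWithinAt) (fun z hz => by
        rw [fderivWithin_of_isOpen isOpen_ball hz, (hderiv z hz).hasFDerivAt.fderiv]
        ext; simp) hz h0
    simp only [hG0, Complex.exp_neg, Complex.exp_log (hF' 0 h0), mul_inv_cancel₀ (hF' 0 h0)] at h1
    rwa [← div_eq_mul_inv, div_eq_one_iff_eq (Complex.exp_ne_zero _)] at h1
  refine exists_integral_norm_rpow_le hlam hp hplam hF0 (fun z hz => ?_) hG fun z hz => ?_
  · rw [← hexp z hz]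
    exact ((hF z hz).differentiableAt (isOpen_ball.mem_nhds hz)).hasDerivAt
  · have hz1 : ‖z‖ < 1 := by simpa using hz
    have : 0 < 1 - ‖z‖ ^ 2 := by nlinarith [norm_nonneg z]
    rw [le_div_iff₀ this, mul_comm]
    exact hT z hz

theorem preSchwarzian_le_of_mem {h g : ℂ → ℂ} {lam : ℝ} (hlam : 0 ≤ lam)
    (hT : preSchwarzianNorm h g ≤ ENNReal.ofReal (2 * lam)) {z : ℂ} (hz : z ∈ ball (0 : ℂ) 1)
    {θ : ℝ} (hθ : θ ∈ Icc (0 : ℝ) (2 * Real.pi)) :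
    deriv h z + Complex.exp (θ * Complex.I) * deriv g z ≠ 0 ∧
      (1 - ‖z‖ ^ 2) *
        ‖(deriv (deriv h) z + Complex.exp (θ * Complex.I) * deriv (deriv g) z) /
          (deriv h z + Complex.exp (θ * Complex.I) * deriv g z)‖ ≤ 2 * lam := by
  rw [preSchwarzianNorm] at hT
  simp only [iSup_le_iff] at hT
  have h1 := hT z hz θ hθ
  split_ifs at h1 with h0
  · exact absurd h1 (not_le.2 ENNReal.ofReal_lt_top)
  · exact ⟨h0, (ENNReal.ofReal_le_ofReal_iff (by linarith)).1 h1⟩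

theorem exists_integral_norm_add_const_mul_rpow_le {h g : ℂ → ℂ} {lam p : ℝ} (hlam : 0 ≤ lam)
    (hp : 0 < p) (hplam : p * (lam ^ 2 - 1) < 1) (hh : DifferentiableOn ℂ h (ball 0 1))
    (hg : DifferentiableOn ℂ g (ball 0 1)) (hh0 : h 0 = 0) (hg0 : g 0 = 0)
    (hT : preSchwarzianNorm h g ≤ ENNReal.ofReal (2 * lam)) {θ₀ : ℝ}
    (hθ₀ : θ₀ ∈ Icc (0 : ℝ) (2 * Real.pi)) {ε : ℂ} (hε : Complex.exp (θ₀ * Complex.I) = ε) :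
    ∃ C, ∀ r ∈ Ioo (0 : ℝ) 1, ∫ θ in (0 : ℝ)..(2 * Real.pi),
      ‖h (r * Complex.exp (θ * Complex.I)) + ε * g (r * Complex.exp (θ * Complex.I))‖ ^ p ≤ C := by
  have hadd : ∀ {u v : ℂ → ℂ}, DifferentiableOn ℂ u (ball 0 1) → DifferentiableOn ℂ v (ball 0 1) →
      ∀ z ∈ ball (0 : ℂ) 1, deriv (fun z => u z + ε * v z) z = deriv u z + ε * deriv v z :=
    fun {u v} hu hv z hz => by
      have hu' := (hu z hz).differentiableAt (isOpen_ball.mem_nhds hz)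
      have hv' := (hv z hz).differentiableAt (isOpen_ball.mem_nhds hz)
      exact (hu'.hasDerivAt.add (hv'.hasDerivAt.const_mul ε)).deriv
  have hadd2 : ∀ z ∈ ball (0 : ℂ) 1, deriv (deriv fun z => h z + ε * g z) z =
      deriv (deriv h) z + ε * deriv (deriv g) z := fun z hz => by
    rw [← hadd (hh.deriv isOpen_ball) (hg.deriv isOpen_ball) z hz]
    refine Filter.EventuallyEq.deriv_eq ?_
    filter_upwards [isOpen_ball.mem_nhds hz] with y hy using hadd hh hg y hy
  refine exists_integral_norm_rpow_le_of_preSchwarzian (F := fun z => h z + ε * g z) hlam hp hplam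
    (hh.add (hg.const_mul ε)) (by simp [hh0, hg0]) (fun z hz => ?_) fun z hz => ?_
  · rw [hadd hh hg z hz, ← hε]
    exact (preSchwarzian_le_of_mem hlam hT hz hθ₀).1
  · rw [hadd2 z hz, hadd hh hg z hz, ← hε]
    exact (preSchwarzian_le_of_mem hlam hT hz hθ₀).2

theorem norm_add_conj_rpow_le {p : ℝ} (hp : 0 < p) (z w : ℂ) :
    ‖z + conj w‖ ^ p ≤ 2 ^ p * (‖z + 1 * w‖ ^ p + ‖z + -1 * w‖ ^ p) := by
  set x := ‖z + 1 * w‖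
  set y := ‖z + -1 * w‖
  have hx : 0 ≤ x := norm_nonneg _
  have hy : 0 ≤ y := norm_nonneg _
  have h1 : 2 * ‖z‖ ≤ x + y := by
    have := norm_add_le (z + 1 * w) (z + -1 * w)
    rwa [show z + 1 * w + (z + -1 * w) = 2 * z by ring, norm_mul, Complex.norm_two] at this
  have h2 : 2 * ‖w‖ ≤ x + y := by
    have := norm_sub_le (z + 1 * w) (z + -1 * w)
    rwa [show z + 1 * w - (z + -1 * w) = 2 * w by ring, norm_mul, Complex.norm_two] at this
  have h3 : ‖z + conj w‖ ≤ 2 * max x y := by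
    have := norm_add_le z (conj w)
    rw [RCLike.norm_conj] at this
    linarith [le_max_left x y, le_max_right x y]
  calc ‖z + conj w‖ ^ p ≤ (2 * max x y) ^ p := Real.rpow_le_rpow (norm_nonneg _) h3 hp.le
    _ = 2 ^ p * max x y ^ p := Real.mul_rpow two_pos.le (le_max_of_le_left hx)
    _ ≤ _ := by
      refine mul_le_mul_of_nonneg_left ?_ (by positivity)
      have := Real.rpow_nonneg hx p
      have := Real.rpow_nonneg hy p
      rcases max_choice x y with h | h <;> rw [h] <;> linarith

theorem harmonicOnNhd_of_isNormalizedDecomposition {f h g : ℂ → ℂ}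
    (hd : IsNormalizedDecomposition f h g) :
    InnerProductSpace.HarmonicOnNhd f (ball 0 1) := fun z hz => by
  have hn := isOpen_ball.mem_nhds hz
  have hsum := (hd.analytic_h.analyticAt hn).harmonicAt.add
    (hd.analytic_g.analyticAt hn).harmonicAt_conj
  refine (InnerProductSpace.harmonicAt_congr_nhds ?_).1 hsum
  filter_upwards [hn] with y hy
  simp [hd.eq_add_conj y hy]

theorem theorem4p2 (lam : ℝ) (hlam : 1 ≤ lam) (p : ℝ) (hp : 0 < p)
    (hplam : 1 < lam → p < 1 / (lam ^ 2 - 1)) :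
    harmonicB lam ⊆ harmonicHardy p := by
  rintro f ⟨h, g, hd, hT⟩
  refine ⟨harmonicOnNhd_of_isNormalizedDecomposition hd, ?_⟩
  have hlam0 : 0 ≤ lam := by linarith
  have hplam' : p * (lam ^ 2 - 1) < 1 := by
    rcases hlam.eq_or_lt with rfl | hlt
    · norm_num
    · exact (lt_div_iff₀ (by nlinarith)).1 (hplam hlt)
  have hpi := Real.pi_pos
  obtain ⟨C₁, hC₁⟩ := exists_integral_norm_add_const_mul_rpow_le hlam0 hp hplam' hd.analytic_h
    hd.analytic_g hd.h_zero hd.g_zero hT (θ₀ := 0) ⟨le_rfl, by linarith⟩ (ε := 1) (by simp)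
  obtain ⟨C₂, hC₂⟩ := exists_integral_norm_add_const_mul_rpow_le hlam0 hp hplam' hd.analytic_h
    hd.analytic_g hd.h_zero hd.g_zero hT (θ₀ := Real.pi) ⟨by linarith, by linarith⟩ (ε := -1)
    Complex.exp_pi_mul_I
  refine ⟨(1 / (2 * Real.pi) * (2 ^ p * (C₁ + C₂))) ^ (1 / p), ?_⟩
  rintro _ ⟨r, hr, rfl⟩
  have hr' := Ioo_subset_Ico_self hr
  have hhc := continuous_comp_circle hd.analytic_h.continuousOn hr'
  have hgc := continuous_comp_circle hd.analytic_g.continuousOn hr'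
  have hint : ∀ ε : ℂ, IntervalIntegrable (fun θ : ℝ => ‖h (r * Complex.exp (θ * Complex.I)) +
      ε * g (r * Complex.exp (θ * Complex.I))‖ ^ p) MeasureTheory.volume 0 (2 * Real.pi) := fun ε =>
    ((hhc.add (hgc.const_mul ε)).norm.rpow_const fun _ => Or.inr hp.le).intervalIntegrable _ _
  refine Real.rpow_le_rpow (mul_nonneg (by positivity) (intervalIntegral.integral_nonneg
    (by positivity) fun θ _ => by positivity)) ?_ (by positivity)
  refine mul_le_mul_of_nonneg_left ?_ (by positivity)
  calc ∫ θ in (0 : ℝ)..(2 * Real.pi), ‖f (r * Complex.exp (θ * Complex.I))‖ ^ p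
      = ∫ θ in (0 : ℝ)..(2 * Real.pi), ‖h (r * Complex.exp (θ * Complex.I)) +
          conj (g (r * Complex.exp (θ * Complex.I)))‖ ^ p :=
        intervalIntegral.integral_congr fun θ _ => by
          simp only [hd.eq_add_conj _ (ofReal_mul_exp_mem_ball hr' θ)]
    _ ≤ ∫ θ in (0 : ℝ)..(2 * Real.pi), 2 ^ p *
          (‖h (r * Complex.exp (θ * Complex.I)) + 1 * g (r * Complex.exp (θ * Complex.I))‖ ^ p +
          ‖h (r * Complex.exp (θ * Complex.I)) + -1 * g (r * Complex.exp (θ * Complex.I))‖ ^ p) := by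
        refine intervalIntegral.integral_mono_on (by positivity) ?_
          (((hint 1).add (hint (-1))).const_mul _) fun θ _ => norm_add_conj_rpow_le hp _ _
        exact ((hhc.add (Complex.continuous_conj.comp hgc)).norm.rpow_const
          fun _ => Or.inr hp.le).intervalIntegrable _ _
    _ ≤ 2 ^ p * (C₁ + C₂) := by
        rw [intervalIntegral.integral_const_mul, intervalIntegral.integral_add (hint 1) (hint (-1))]
        exact mul_le_mul_of_nonneg_left (add_le_add (hC₁ r hr) (hC₂ r hr)) (by positivity)
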